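/- Let $M, j_0 \ge 0$ be integers and let $\mathcal N$ be a finite set. Consider an ergodic continuous-time Markov chain on $\mathcal N \cup \{(m,j) : 0\le m\le M,\ j\ge j_0\}$, with $q(x,y)\ge 0$ the rate of transitions from $x$ to $y\neq x$ (and $q(x,x)=0$), whose only possible transitions are: arbitrary transitions inside $\mathcal N$; arbitrary transitions between $\mathcal N$ and the states $(m,j_0)$, in both directions; $(m,j)\to(m,j+1)$ at rate $\lambda_m$; $(m,j+1)\to(m,j)$ at rate $\mu_m$; and, for $m<i\le M$ and $\Delta\in\{-1,0,1\}$ with $j,\ j+\Delta\ge j_0$, $(m,j)\to(i,j+\Delta)$ at rate $\alpha_m\langle i-m\rangle\langle\Delta\rangle$ (a class $\mathbb M$ chain). Put $\alpha_m=\sum_{i=m+1}^M\sum_{\Delta=-1}^1\alpha_m\langle i-m\rangle\langle\Delta\rangle$ and assume $\lambda_m,\mu_m>0$ for all $m$. Let $$\phi_m=\frac{\alpha_m+\lambda_m+\mu_m-\sqrt{(\alpha_m+\lambda_m+\mu_m)^2-4\lambda_m\mu_m}}{2\lambda_m},\qquad r_m=\frac{\lambda_m}{\mu_m}\phi_m,\qquad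 \Omega_m=\frac{r_m}{\lambda_m(1-r_m\phi_m)},$$ and assume $r_0=r_1=\cdots=r_M$. Let $\pi$ be the stationary distribution. Then there are real numbers $c_{m,k}$ $(0\le k\le m\le M)$ such that for all $0\le m\le M$ and $j\ge j_0$ $$\pi_{(m,j)}=\sum_{k=0}^m c_{m,k}\binom{j-(j_0+1)+k}{k}r_0^{\,j-j_0}$$ (where $\binom{-1}{0}=1$), and they satisfy $$c_{m,0}=\pi_{(m,j_0)}\qquad(0\le m\le M),$$ $$c_{m,k}=\Omega_m r_0\sum_{u=k}^{m-1}\sum_{i=u}^{m-1}c_{i,u}\sum_{\Delta=-1}^1\frac{\alpha_i\langle m-i\rangle\langle\Delta\rangle\,\phi_m^{\Delta+1}}{(1-r_0\phi_m)^{u+1-k}}-\frac1{\lambda_m}\sum_{i=k}^{m-1}c_{i,k}\,\alpha_i\langle m-i\rangle\langle1\rangle+\Omega_m\sum_{i=k-1}^{m-1}c_{i,k-1}\sum_{\Delta=-1}^1\alpha_i\langle m-i\rangle\langle\Delta\rangle\, r_0^{-\Delta}\qquad(1\le k\le m-1,\ m\le M),$$ $$c_{m,m}=c_{m-1,m-1}\,\Omega_m\sum_{\Delta=-1}^1\alpha_{m-1}\langle1\rangle\langle\Delta\rangle\,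 r_0^{-\Delta}\qquad(1\le m\le M),$$ together with the balance equations of the states $(m,j_0)$, $0\le m\le M$, $$\pi_{(m,j_0)}\Big(\lambda_m+\sum_{i=m+1}^M\sum_{\Delta=0}^1\alpha_m\langle i-m\rangle\langle\Delta\rangle+\sum_{x\in\mathcal N}q((m,j_0),x)\Big)=\mu_m\sum_{k=0}^m c_{m,k}r_0+\sum_{x\in\mathcal N}q(x,(m,j_0))\pi_x+\sum_{i=0}^{m-1}\Big(\alpha_i\langle m-i\rangle\langle-1\rangle\sum_{k=0}^i c_{i,k}r_0+\alpha_i\langle m-i\rangle\langle0\rangle\,\pi_{(i,j_0)}\Big),$$ those of the states $x\in\mathcal N$, $$\pi_x\Big(\sum_{m=0}^M q(x,(m,j_0))+\sum_{y\in\mathcal N}q(x,y)\Big)=\sum_{m=0}^M q((m,j_0),x)\pi_{(m,j_0)}+\sum_{y\in\mathcal N}q(y,x)\pi_y,$$ and the normalization $$\sum_{x\in\mathcal N}\pi_x+\sum_{m=0}^M\Big(\frac{c_{m,0}}{1-r_0}+\sum_{k=1}^m\frac{c_{m,k}\,r_0}{(1-r_0)^{k+1}}\Big)=1.$$ -/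

import Mathlib

/-- The state space `𝓝 ∪ 𝓡`: a non-repeating portion `N`, and the repeating portion consisting of
the pairs `(m, j)` of a phase `0 ≤ m ≤ M` and a level `j ≥ j₀`. -/
abbrev State (N : Type*) (M j₀ : ℕ) : Type _ :=
  N ⊕ (Fin (M + 1) × {j : ℕ // j₀ ≤ j})

/-- The state `(m, j)` of the repeating portion. -/
abbrev State.rep {N : Type*} {M j₀ : ℕ} (m : Fin (M + 1)) (j : ℕ) (hj : j₀ ≤ j) :
    State N M j₀ :=
  Sum.inr (m, ⟨j, hj⟩)

/-- The transition rates of a class M continuous time Markov chain with non-repeating portion `N`,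
phases `0, …, M` and levels `j₀, j₀ + 1, …`. Phases are indexed by natural numbers; only the values
at phases `≤ M` are used. A transition rate from a state to itself is `0` by convention. -/
structure ClassM (N : Type*) (M j₀ : ℕ) where
  /-- rate of `(m, j) → (m, j + 1)` -/
  lam : ℕ → ℝ
  /-- rate of `(m, j + 1) → (m, j)` -/
  mu : ℕ → ℝ
  /-- `alp m d Δ` is the rate of `(m, j) → (m + d, j + Δ)`, for `d ≥ 1` and `Δ ∈ {-1, 0, 1}` -/
  alp : ℕ → ℕ → ℤ → ℝ
  /-- rates inside the non-repeating portion -/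
  qNN : N → N → ℝ
  /-- `qNR x m` is the rate of `x → (m, j₀)` -/
  qNR : N → Fin (M + 1) → ℝ
  /-- `qRN m x` is the rate of `(m, j₀) → x` -/
  qRN : Fin (M + 1) → N → ℝ
  lam_nonneg : ∀ m ≤ M, 0 ≤ lam m
  mu_nonneg : ∀ m ≤ M, 0 ≤ mu m
  alp_nonneg : ∀ m i, m < i → i ≤ M → ∀ Δ ∈ Finset.Icc (-1 : ℤ) 1, 0 ≤ alp m (i - m) Δ
  qNN_nonneg : ∀ x y, 0 ≤ qNN x y
  qNN_self : ∀ x, qNN x x = 0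
  qNR_nonneg : ∀ x m, 0 ≤ qNR x m
  qRN_nonneg : ∀ m x, 0 ≤ qRN m x

noncomputable section

namespace ClassM

variable {N : Type*} {M j₀ : ℕ}

/-- The transition rate `q(x, y)` from state `x` to state `y`. -/
def rate (C : ClassM N M j₀) : State N M j₀ → State N M j₀ → ℝ
  | Sum.inl x, Sum.inl y => C.qNN x y
  | Sum.inl x, Sum.inr (m, j) => if (j : ℕ) = j₀ then C.qNR x m else 0
  | Sum.inr (m, j), Sum.inl x => if (j : ℕ) = j₀ then C.qRN m x else 0
  | Sum.inr (m, j), Sum.inr (i, l) =>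
      if i = m then
        if (l : ℕ) = j + 1 then C.lam m
        else if (j : ℕ) = l + 1 then C.mu m
        else 0
      else if m < i ∧ |(l : ℤ) - (j : ℤ)| ≤ 1 then
        C.alp m (i - m) ((l : ℤ) - (j : ℤ))
      else 0

/-- Every state can be reached from every other one by transitions of positive rate. -/
def IsIrreducible (C : ClassM N M j₀) : Prop :=
  ∀ x y : State N M j₀, Relation.ReflTransGen (fun a b => 0 < C.rate a b) x y

/-- `π` is a stationary distribution: a probability distribution on the states that satisfies the
global balance equations. All sums over `y` have only finitely many nonzero terms when `N` is
finite. -/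
structure IsStationary (C : ClassM N M j₀) (π : State N M j₀ → ℝ) : Prop where
  nonneg : ∀ x, 0 ≤ π x
  hasSum_one : HasSum π 1
  balance : ∀ x, π x * ∑' y, C.rate x y = ∑' y, π y * C.rate y x

/-- Ergodicity: the chain is irreducible and positive recurrent. When `N` is finite, the transition
rates are bounded, so the chain does not explode, and positive recurrence of the irreducible chain
is the existence of a stationary distribution (which is then unique and is the limiting
distribution). -/
def IsErgodic (C : ClassM N M j₀) : Prop :=
  C.IsIrreducible ∧ ∃ π : State N M j₀ → ℝ, C.IsStationary π

/-- `α_m`, the total transition rate to other phases from a state `(m, j)` with `j ≥ j₀ + 1`. -/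
def alphaTot (C : ClassM N M j₀) (m : ℕ) : ℝ :=
  ∑ i ∈ Finset.Ioc m M, ∑ Δ ∈ Finset.Icc (-1 : ℤ) 1, C.alp m (i - m) Δ

/-- `ρ_m = λ_m / μ_m`. -/
def rho (C : ClassM N M j₀) (m : ℕ) : ℝ := C.lam m / C.mu m

/-- `φ_m(s)`, the Laplace transform of the M/M/1 busy period with rates `λ_m` and `μ_m`. -/
def phi (C : ClassM N M j₀) (m : ℕ) (s : ℝ) : ℝ :=
  (s + C.lam m + C.mu m - √((s + C.lam m + C.mu m) ^ 2 - 4 * C.lam m * C.mu m)) / (2 * C.lam m)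

/-- The base `r_m`. -/
def base (C : ClassM N M j₀) (m : ℕ) : ℝ :=
  if 0 < C.mu m then C.rho m * C.phi m (C.alphaTot m) else C.lam m / (C.lam m + C.alphaTot m)

/-- `Ω_m = r_m / (λ_m (1 - r_m φ_m(α_m)))`. -/
def Omega (C : ClassM N M j₀) (m : ℕ) : ℝ :=
  C.base m / (C.lam m * (1 - C.base m * C.phi m (C.alphaTot m)))

end ClassM

end

/-!
Above level `j₀` the balance equations of phase `m` form a linear recurrence of order two, forced
by the phases below `m`, with characteristic roots `r_m` and `1 / φ_m ≥ 1`. A solution that tends to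
`0` is therefore determined by its value at level `j₀`. As all the bases are equal to `r = r₀ < 1`,
each phase resonates with the phases below it, and the degree of the polynomial factor grows by one
per phase. In the basis `n ↦ C(n - 1 + k, k)`, with `n = j - j₀`, replacing `n` by `n - 1` acts on
coefficient sequences as `1 - S`, where `(S c)_k = c_{k+1}`. So the recurrence becomes
`λ_m (1 - r φ_m - S) S c = forcing`, and inverting `1 - r φ_m - S` on finitely supported sequences
produces the tail sums over `u`. Conversely, these coefficients give a solution of the recurrence
that decays, which by uniqueness is `π`.
-/

open Filter Topology Finset

section Recurrence

variable {x : ℕ → ℝ} {r φ : ℝ}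

theorem mul_le_succ_of_le_of_tendsto_zero (hφ0 : 0 ≤ φ) (hφ1 : φ ≤ 1)
    (hx : Tendsto x atTop (𝓝 0))
    (h : ∀ n, r * x n + φ * x (n + 2) ≤ (1 + r * φ) * x (n + 1)) (n : ℕ) :
    r * x n ≤ x (n + 1) := by
  let d : ℕ → ℝ := fun n => x (n + 1) - r * x n
  have hd : ∀ k, φ ^ k * d (n + k) ≤ d n := by
    intro k
    induction k with
    | zero => simp
    | succ k ih =>
      have hstep : φ * d (n + k + 1) ≤ d (n + k) := by linarith [h (n + k)]
      calc φ ^ (k + 1) * d (n + (k + 1)) = φ ^ k * (φ * d (n + k + 1)) := by ring_nf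
        _ ≤ φ ^ k * d (n + k) := by gcongr
        _ ≤ d n := ih
  have hd_lim : Tendsto (fun k => d (n + k)) atTop (𝓝 0) := by
    have h_lim := ((tendsto_add_atTop_iff_nat 1).2 hx).sub (hx.const_mul r)
    simp only [mul_zero, sub_zero] at h_lim
    simpa only [add_comm n] using (tendsto_add_atTop_iff_nat n).2 h_lim
  have hlim : Tendsto (fun k => φ ^ k * d (n + k)) atTop (𝓝 0) := by
    refine squeeze_zero_norm (fun k => ?_) (tendsto_zero_iff_norm_tendsto_zero.1 hd_lim)
    rw [norm_mul, Real.norm_of_nonneg (pow_nonneg hφ0 k)]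
    exact mul_le_of_le_one_left (norm_nonneg _) (pow_le_one₀ hφ0 hφ1)
  exact sub_nonneg.1 (le_of_tendsto' hlim hd)

theorem eq_pow_mul_of_recurrence_of_tendsto_zero (hφ0 : 0 ≤ φ) (hφ1 : φ ≤ 1)
    (hx : Tendsto x atTop (𝓝 0))
    (h : ∀ n, (1 + r * φ) * x (n + 1) = r * x n + φ * x (n + 2)) (n : ℕ) :
    x n = r ^ n * x 0 := by
  have hsucc : ∀ k, x (k + 1) = r * x k := by
    intro k
    have hle := mul_le_succ_of_le_of_tendsto_zero hφ0 hφ1 hx (fun n => (h n).ge) k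
    have hge := mul_le_succ_of_le_of_tendsto_zero (x := -x) (r := r) hφ0 hφ1
      (by simpa only [neg_zero] using! hx.neg)
      (fun n => by simp only [Pi.neg_apply]; linarith [h n]) k
    simp only [Pi.neg_apply] at hge
    linarith
  induction n with
  | zero => simp
  | succ n ih => rw [hsucc, ih]; ring

end Recurrence

/-- The value at `n` of the combination of the sequences `n ↦ C(n - 1 + k, k)`, `k ≤ d`, with
coefficients `a`. For a degree bound `d` these sequences form a basis of the polynomials in `n`. -/
def multichooseSum {R : Type*} [Semiring R] (d : ℕ) (a : ℕ → R) (n : ℕ) : R :=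
  ∑ k ∈ range (d + 1), a k * (Nat.multichoose n k : R)

section MultichooseSum

variable {R : Type*}

theorem multichooseSum_zero [Semiring R] (d : ℕ) (a : ℕ → R) : multichooseSum d a 0 = a 0 := by
  simp [multichooseSum, sum_range_succ']

theorem multichooseSum_one [Semiring R] (d : ℕ) (a : ℕ → R) :
    multichooseSum d a 1 = ∑ k ∈ range (d + 1), a k := by
  simp [multichooseSum]

theorem multichooseSum_eq_of_le [Semiring R] {d e : ℕ} (hde : d ≤ e) {a : ℕ → R}
    (ha : ∀ k, d < k → a k = 0) (n : ℕ) : multichooseSum d a n = multichooseSum e a n := by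
  refine sum_subset (range_subset_range.2 (by omega)) fun k _ hk => ?_
  rw [ha k (by simpa using hk), zero_mul]

theorem multichooseSum_eq_succ_add [Ring R] (d : ℕ) (a : ℕ → R) (n : ℕ) :
    multichooseSum d a n =
      multichooseSum d (fun k => a k - a (k + 1)) (n + 1)
        + a (d + 1) * (Nat.multichoose (n + 1) d : R) := by
  induction d with
  | zero => simp [multichooseSum]
  | succ d ih =>
    rw [multichooseSum, sum_range_succ, ← multichooseSum, ih, multichooseSum,
      multichooseSum, sum_range_succ _ (d + 1), Nat.multichoose_succ_succ]
    push_cast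
    noncomm_ring

theorem multichooseSum_eq_succ [Ring R] {d : ℕ} {a : ℕ → R} (ha : a (d + 1) = 0) (n : ℕ) :
    multichooseSum d a n = multichooseSum d (fun k => a k - a (k + 1)) (n + 1) := by
  rw [multichooseSum_eq_succ_add, ha, zero_mul, add_zero]

theorem multichooseSum_eq_add_two [Ring R] {d : ℕ} {a : ℕ → R} (ha : ∀ k, d < k → a k = 0)
    (n : ℕ) :
    multichooseSum d a n =
      multichooseSum d (fun k => a k - a (k + 1) - (a (k + 1) - a (k + 2))) (n + 2) := by
  rw [multichooseSum_eq_succ (ha _ (by omega)), multichooseSum_eq_succ]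
  rw [ha _ (by omega), ha _ (by omega), sub_zero]

variable {𝕜 : Type*} [NormedField 𝕜] {r : 𝕜}

theorem hasSum_multichoose_succ_mul_geometric (hr : ‖r‖ < 1) (k : ℕ) :
    HasSum (fun n : ℕ => (Nat.multichoose n (k + 1) : 𝕜) * r ^ n) (r / (1 - r) ^ (k + 2)) := by
  have hshift (n : ℕ) : (Nat.multichoose (n + 1) (k + 1) : 𝕜) * r ^ (n + 1) =
      r * ((n + (k + 1)).choose (k + 1) * r ^ n) := by
    rw [Nat.multichoose_eq, show n + 1 + (k + 1) - 1 = n + (k + 1) by omega]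
    ring
  rw [← hasSum_nat_add_iff' 1]
  simpa [hshift, div_eq_mul_inv] using
    (hasSum_choose_mul_geometric_of_norm_lt_one (k + 1) hr).mul_left r

theorem hasSum_multichooseSum_mul_pow (hr : ‖r‖ < 1) (d : ℕ) (a : ℕ → 𝕜) :
    HasSum (fun n => multichooseSum d a n * r ^ n)
      (a 0 / (1 - r) + ∑ k ∈ Icc 1 d, a k * r / (1 - r) ^ (k + 1)) := by
  have hIcc : ∑ k ∈ Icc 1 d, a k * r / (1 - r) ^ (k + 1) =
      ∑ k ∈ range d, a (k + 1) * (r / (1 - r) ^ (k + 2)) := by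
    rw [← Ico_succ_right_eq_Icc, sum_Ico_eq_sum_range]
    refine sum_congr (by simp) fun k _ => ?_
    rw [mul_div_assoc, add_comm 1 k]
  have hzero : HasSum (fun n => a 0 * r ^ n) (a 0 / (1 - r)) := by
    simpa only [div_eq_mul_inv] using (hasSum_geometric_of_norm_lt_one hr).mul_left (a 0)
  have hsucc : HasSum (fun n => ∑ k ∈ range d, a (k + 1) * (Nat.multichoose n (k + 1) * r ^ n))
      (∑ k ∈ range d, a (k + 1) * (r / (1 - r) ^ (k + 2))) :=
    hasSum_sum fun k _ => (hasSum_multichoose_succ_mul_geometric hr k).mul_left _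
  rw [hIcc, add_comm]
  convert hsucc.add hzero using 2 with n
  simp [multichooseSum, sum_range_succ', add_mul, sum_mul, mul_assoc]

end MultichooseSum

section Coefficients

variable {K : Type*} [Field K]

theorem tail_sum_recurrence {b : ℕ → K} {m : ℕ} (hb : ∀ u, m ≤ u → b u = 0) {w : K} (hw : w ≠ 0)
    (k : ℕ) :
    w * ∑ u ∈ Ico k m, b u / w ^ (u + 1 - k) - ∑ u ∈ Ico (k + 1) m, b u / w ^ (u + 1 - (k + 1)) =
      b k := by
  rcases lt_or_ge k m with hk | hk
  · have hterm (u) (hu : u ∈ Ico (k + 1) m) :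
        w * (b u / w ^ (u + 1 - k)) = b u / w ^ (u + 1 - (k + 1)) := by
      rw [show u + 1 - k = u + 1 - (k + 1) + 1 by have := mem_Ico.1 hu; omega, pow_succ]
      field_simp
    rw [sum_eq_sum_Ico_succ_bot hk, mul_add, mul_sum, sum_congr rfl hterm, add_sub_cancel_right,
      Nat.add_sub_cancel_left, pow_one, mul_div_cancel₀ _ hw]
  · simp [Ico_eq_empty_of_le hk, Ico_eq_empty_of_le (hk.trans k.le_succ), hb k hk]

theorem coeff_difference_eq {A : ℤ → ℕ → K} {c T : ℕ → K} {r φ lam : K}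
    (hr : r ≠ 0) (hlam : lam ≠ 0) (hw : 1 - r * φ ≠ 0)
    (hT : ∀ k, (1 - r * φ) * T k - T (k + 1) = A (-1) k + A 0 k * φ + A 1 k * φ ^ 2)
    (hc : ∀ k, c (k + 1) =
      r / (lam * (1 - r * φ)) * r * T (k + 1) - 1 / lam * A 1 (k + 1)
        + r / (lam * (1 - r * φ)) * (A (-1) k * r + A 0 k + A 1 k / r)) (k : ℕ) :
    lam * ((1 - r * φ) * c (k + 1) - c (k + 2)) =
      r ^ 2 * A (-1) k + r * (A 0 k - A 0 (k + 1))
        + (A 1 k - A 1 (k + 1) - (A 1 (k + 1) - A 1 (k + 2))) := by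
  rw [hc k, hc (k + 1), ← sub_eq_iff_eq_add.2 (sub_eq_iff_eq_add'.1 (hT (k + 1)))]
  field_simp
  ring

end Coefficients

theorem multichooseSum_mul_pow_recurrence {R : Type*} [CommRing R] {d : ℕ} {A : ℤ → ℕ → R}
    {c : ℕ → R} {r φ lam mu s : R}
    (hA : ∀ Δ k, d < k → A Δ k = 0) (hcd : ∀ k, d < k → c k = 0)
    (hmu : mu * r = lam * φ) (hs : s * r = lam * (1 + r * φ))
    (hc : ∀ k, lam * ((1 - r * φ) * c (k + 1) - c (k + 2)) =
      r ^ 2 * A (-1) k + r * (A 0 k - A 0 (k + 1))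
        + (A 1 k - A 1 (k + 1) - (A 1 (k + 1) - A 1 (k + 2)))) (n : ℕ) :
    s * (multichooseSum d c (n + 1) * r ^ (n + 1)) =
      lam * (multichooseSum d c n * r ^ n) + mu * (multichooseSum d c (n + 2) * r ^ (n + 2))
        + multichooseSum d (A 1) n * r ^ n + multichooseSum d (A 0) (n + 1) * r ^ (n + 1)
        + multichooseSum d (A (-1)) (n + 2) * r ^ (n + 2) := by
  rw [multichooseSum_eq_add_two hcd n, multichooseSum_eq_succ (hcd _ d.lt_succ_self) (n + 1),
    multichooseSum_eq_add_two (hA 1) n, multichooseSum_eq_succ (hA 0 _ d.lt_succ_self) (n + 1)]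
  simp only [multichooseSum, sum_mul, mul_sum, ← sum_add_distrib]
  refine sum_congr rfl fun k _ => ?_
  linear_combination (Nat.multichoose (n + 2) k : R) * r ^ n *
    (hc k + (c k - c (k + 1)) * hs - r * c k * hmu)

theorem sum_Icc_neg_one_one {R : Type*} [AddCommMonoid R] (f : ℤ → R) :
    ∑ Δ ∈ Icc (-1 : ℤ) 1, f Δ = f (-1) + f 0 + f 1 := by
  rw [show Icc (-1 : ℤ) 1 = {-1, 0, 1} by decide, sum_insert (by decide),
    sum_insert (by decide), sum_singleton, add_assoc]

theorem sum_Ico_mul_eq_sum_range_mul {R : Type*} [NonUnitalNonAssocSemiring R] {a f : ℕ → R}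
    {k m : ℕ} (ha : ∀ i < k, a i = 0) : ∑ i ∈ Ico k m, a i * f i = ∑ i ∈ range m, a i * f i := by
  refine sum_subset (fun i hi => mem_range.2 (mem_Ico.1 hi).2) fun i him hik => ?_
  rw [ha i (by rw [mem_range] at him; rw [mem_Ico] at hik; omega), zero_mul]

namespace ClassM

variable {N : Type*} {M j₀ : ℕ} (C : ClassM N M j₀) {m : ℕ}

section Parameters

theorem alphaTot_nonneg (m : ℕ) : 0 ≤ C.alphaTot m :=
  sum_nonneg fun i hi => sum_nonneg fun Δ hΔ =>
    C.alp_nonneg m i (mem_Ioc.1 hi).1 (mem_Ioc.1 hi).2 Δ hΔ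

theorem phi_quadratic (hm : m ≤ M) (hlam : 0 < C.lam m) :
    (C.lam m + C.mu m + C.alphaTot m) * C.phi m (C.alphaTot m) =
      C.lam m * C.phi m (C.alphaTot m) ^ 2 + C.mu m := by
  have hα := C.alphaTot_nonneg m
  have hμ := C.mu_nonneg m hm
  have hdiscr : 0 ≤ (C.alphaTot m + C.lam m + C.mu m) ^ 2 - 4 * C.lam m * C.mu m := by
    nlinarith [sq_nonneg (C.lam m - C.mu m), mul_nonneg hα hlam.le, mul_nonneg hα hμ,
      sq_nonneg (C.alphaTot m)]
  have hsq := Real.sq_sqrt hdiscr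
  rw [phi]
  generalize √((C.alphaTot m + C.lam m + C.mu m) ^ 2 - 4 * C.lam m * C.mu m) = t at hsq
  field_simp
  linear_combination -hsq

theorem phi_nonneg (hm : m ≤ M) (hlam : 0 < C.lam m) : 0 ≤ C.phi m (C.alphaTot m) := by
  have hα := C.alphaTot_nonneg m
  have hμ := C.mu_nonneg m hm
  refine div_nonneg (sub_nonneg.2 ((Real.sqrt_le_left (by positivity)).2 ?_)) (by positivity)
  exact sub_le_self _ (by positivity)

theorem phi_le_one (hlam : 0 < C.lam m) : C.phi m (C.alphaTot m) ≤ 1 := by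
  have hα := C.alphaTot_nonneg m
  have hsqrt : C.alphaTot m + C.mu m - C.lam m ≤
      √((C.alphaTot m + C.lam m + C.mu m) ^ 2 - 4 * C.lam m * C.mu m) :=
    Real.le_sqrt_of_sq_le (by nlinarith [mul_nonneg hα hlam.le])
  rw [phi, div_le_one (by positivity)]
  linarith

theorem phi_eq_zero_of_mu_eq_zero (hlam : 0 < C.lam m) (hmu : C.mu m = 0) :
    C.phi m (C.alphaTot m) = 0 := by
  have hα := C.alphaTot_nonneg m
  rw [phi, hmu, mul_zero, sub_zero, Real.sqrt_sq (by positivity), sub_self, zero_div]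

theorem mu_mul_base (hm : m ≤ M) (hlam : 0 < C.lam m) :
    C.mu m * C.base m = C.lam m * C.phi m (C.alphaTot m) := by
  rcases (C.mu_nonneg m hm).eq_or_lt with hmu | hmu
  · rw [C.phi_eq_zero_of_mu_eq_zero hlam hmu.symm, ← hmu, zero_mul, mul_zero]
  · rw [base, if_pos hmu, rho]
    field_simp

theorem rate_mul_base (hm : m ≤ M) (hlam : 0 < C.lam m) :
    (C.lam m + C.mu m + C.alphaTot m) * C.base m =
      C.lam m * (1 + C.base m * C.phi m (C.alphaTot m)) := by
  rcases (C.mu_nonneg m hm).eq_or_lt with hmu | hmu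
  · have hα := C.alphaTot_nonneg m
    rw [C.phi_eq_zero_of_mu_eq_zero hlam hmu.symm, base, ← hmu, if_neg (lt_irrefl 0)]
    field_simp
    ring
  · apply mul_left_cancel₀ hmu.ne'
    linear_combination C.lam m * C.phi_quadratic hm hlam +
      (C.lam m + C.mu m + C.alphaTot m - C.lam m * C.phi m (C.alphaTot m)) *
        C.mu_mul_base hm hlam

theorem base_pos (hm : m ≤ M) (hlam : 0 < C.lam m) : 0 < C.base m := by
  have hα := C.alphaTot_nonneg m
  have hφ := C.phi_nonneg hm hlam
  rw [base]
  split_ifs with hmu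
  · have hφ' : C.phi m (C.alphaTot m) ≠ 0 := by
      intro h
      have := C.phi_quadratic hm hlam
      simp [h, hmu.ne] at this
    have := hφ.lt_of_ne' hφ'
    rw [rho]
    positivity
  · positivity

end Parameters

section Coefficients

/-- The inflow into phase `m` from the lower phases through transitions changing the level by `Δ`,
when phase `i` holds the mass `f i n` at the level of origin `n`. -/
def inflow (f : ℕ → ℕ → ℝ) (m : ℕ) (Δ : ℤ) (n : ℕ) : ℝ :=
  ∑ i ∈ range m, C.alp i (m - i) Δ * f i n

theorem inflow_congr {f g : ℕ → ℕ → ℝ} {n : ℕ} (h : ∀ i < m, f i n = g i n) (Δ : ℤ) :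
    C.inflow f m Δ n = C.inflow g m Δ n :=
  sum_congr rfl fun i hi => by rw [h i (mem_range.1 hi)]

theorem inflow_nonneg (hm : m ≤ M) {Δ : ℤ} (hΔ : Δ ∈ Icc (-1) 1) {f : ℕ → ℕ → ℝ} {n : ℕ}
    (hf : ∀ i < m, 0 ≤ f i n) : 0 ≤ C.inflow f m Δ n :=
  sum_nonneg fun i hi =>
    mul_nonneg (C.alp_nonneg i m (mem_range.1 hi) hm Δ hΔ) (hf i (mem_range.1 hi))

theorem inflow_eq_zero {f : ℕ → ℕ → ℝ} {n : ℕ} (hf : ∀ i < m, f i n = 0) (Δ : ℤ) :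
    C.inflow f m Δ n = 0 :=
  sum_eq_zero fun i hi => by rw [hf i (mem_range.1 hi), mul_zero]

theorem multichooseSum_inflow_mul_pow (d : ℕ) (a : ℕ → ℕ → ℝ) (m : ℕ) (Δ : ℤ) (n : ℕ) (r : ℝ) :
    multichooseSum d (C.inflow a m Δ) n * r ^ n =
      C.inflow (fun i n => multichooseSum d (a i) n * r ^ n) m Δ n := by
  simp only [multichooseSum, inflow, sum_mul, mul_sum]
  rw [sum_comm]
  simp only [mul_assoc]

theorem sum_Ico_mul_alp {a : ℕ → ℕ → ℝ} {u : ℕ} (ha : ∀ i < u, a i u = 0) (m : ℕ) (Δ : ℤ) :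
    ∑ i ∈ Ico u m, a i u * C.alp i (m - i) Δ = C.inflow a m Δ u := by
  rw [sum_Ico_mul_eq_sum_range_mul ha, inflow]
  exact sum_congr rfl fun _ _ => mul_comm _ _

theorem sum_Ico_mul_sum_alp {a : ℕ → ℕ → ℝ} {u : ℕ} (ha : ∀ i < u, a i u = 0) (m : ℕ)
    (w : ℤ → ℝ) :
    ∑ i ∈ Ico u m, a i u * ∑ Δ ∈ Icc (-1 : ℤ) 1, C.alp i (m - i) Δ * w Δ =
      ∑ Δ ∈ Icc (-1 : ℤ) 1, C.inflow a m Δ u * w Δ := by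
  simp only [mul_sum, ← C.sum_Ico_mul_alp ha, sum_mul]
  rw [sum_comm]
  simp only [mul_assoc]

/-- The coefficient of index `k ≥ 1` of phase `m`, expressed through the coefficients `a i u` of
the phases `i < m`. -/
noncomputable def coeffStep (a : ℕ → ℕ → ℝ) (m k : ℕ) : ℝ :=
  C.Omega m * C.base 0 *
      (∑ u ∈ Ico k m, ∑ i ∈ Ico u m,
        a i u * ∑ Δ ∈ Icc (-1 : ℤ) 1,
          C.alp i (m - i) Δ * C.phi m (C.alphaTot m) ^ (Δ + 1) /
            (1 - C.base 0 * C.phi m (C.alphaTot m)) ^ (u + 1 - k))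
    - 1 / C.lam m * (∑ i ∈ Ico k m, a i k * C.alp i (m - i) 1)
    + C.Omega m *
      (∑ i ∈ Ico (k - 1) m,
        a i (k - 1) * ∑ Δ ∈ Icc (-1 : ℤ) 1,
          C.alp i (m - i) Δ * C.base 0 ^ (-Δ))

theorem coeffStep_congr {a b : ℕ → ℕ → ℝ} (h : ∀ i < m, ∀ u, a i u = b i u) (k : ℕ) :
    C.coeffStep a m k = C.coeffStep b m k := by
  have hIco : ∀ {l i : ℕ} (u : ℕ), i ∈ Ico l m → a i u = b i u :=
    fun u hi => h _ (mem_Ico.1 hi).2 u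
  unfold coeffStep
  congr 1
  · congr 2
    · exact sum_congr rfl fun u _ => sum_congr rfl fun i hi => by rw [hIco u hi]
    · exact sum_congr rfl fun i hi => by rw [hIco k hi]
  · congr 1
    exact sum_congr rfl fun i hi => by rw [hIco (k - 1) hi]

/-- The coefficients `c_{m,k}` of the stationary probabilities of phase `m`, given the
probabilities `p₀` of the states at level `j₀`. -/
noncomputable def coeff (p₀ : ℕ → ℝ) (m : ℕ) : ℕ → ℝ
  | 0 => p₀ m
  | k + 1 => C.coeffStep (fun i u => if _h : i < m then coeff p₀ i u else 0) m (k + 1)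
termination_by m

theorem coeff_zero (p₀ : ℕ → ℝ) (m : ℕ) : C.coeff p₀ m 0 = p₀ m := by
  rw [coeff]

theorem coeff_eq_coeffStep (p₀ : ℕ → ℝ) (m : ℕ) {k : ℕ} (hk : 1 ≤ k) :
    C.coeff p₀ m k = C.coeffStep (C.coeff p₀) m k := by
  obtain ⟨k, rfl⟩ := Nat.exists_eq_add_of_le' hk
  rw [coeff]
  exact C.coeffStep_congr (fun i hi u => by rw [dif_pos hi]) (k + 1)

theorem coeff_eq_zero (p₀ : ℕ → ℝ) {k : ℕ} (hk : m < k) : C.coeff p₀ m k = 0 := by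
  rw [C.coeff_eq_coeffStep p₀ m (by omega), coeffStep, Ico_eq_empty_of_le hk.le,
    Ico_eq_empty_of_le (by omega : m ≤ k - 1)]
  simp only [sum_empty, mul_zero, sub_zero, add_zero]

theorem coeff_self (p₀ : ℕ → ℝ) (hm : 1 ≤ m) :
    C.coeff p₀ m m = C.coeff p₀ (m - 1) (m - 1) * C.Omega m *
      ∑ Δ ∈ Icc (-1 : ℤ) 1, C.alp (m - 1) 1 Δ * C.base 0 ^ (-Δ) := by
  have hIco : Ico (m - 1) m = {m - 1} := by
    rw [← Nat.Ico_succ_singleton, Nat.sub_add_cancel hm]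
  rw [C.coeff_eq_coeffStep p₀ m hm, coeffStep, hIco, sum_singleton, Nat.sub_sub_self hm,
    Ico_self]
  simp only [sum_empty, mul_zero, sub_zero, zero_add]
  ring

theorem coeff_succ (p₀ : ℕ → ℝ) (hbase : C.base m = C.base 0) (k : ℕ) :
    C.coeff p₀ m (k + 1) =
      C.base 0 / (C.lam m * (1 - C.base 0 * C.phi m (C.alphaTot m))) * C.base 0 *
          (∑ u ∈ Ico (k + 1) m,
            (C.inflow (C.coeff p₀) m (-1) u + C.inflow (C.coeff p₀) m 0 u * C.phi m (C.alphaTot m)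
              + C.inflow (C.coeff p₀) m 1 u * C.phi m (C.alphaTot m) ^ 2) /
                (1 - C.base 0 * C.phi m (C.alphaTot m)) ^ (u + 1 - (k + 1)))
        - 1 / C.lam m * C.inflow (C.coeff p₀) m 1 (k + 1)
        + C.base 0 / (C.lam m * (1 - C.base 0 * C.phi m (C.alphaTot m))) *
          (C.inflow (C.coeff p₀) m (-1) k * C.base 0 + C.inflow (C.coeff p₀) m 0 k
            + C.inflow (C.coeff p₀) m 1 k / C.base 0) := by
  have hvanish : ∀ u, ∀ i < u, C.coeff p₀ i u = 0 := fun u i => C.coeff_eq_zero p₀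
  rw [C.coeff_eq_coeffStep p₀ m (by omega), coeffStep, Omega, hbase]
  simp only [mul_div_assoc, Nat.add_sub_cancel, C.sum_Ico_mul_sum_alp (hvanish _),
    C.sum_Ico_mul_alp (hvanish _)]
  simp only [sum_Icc_neg_one_one]
  norm_num [div_eq_mul_inv, add_mul, mul_assoc]

/-- The balance equations of the states `(m, j₀ + n + 1)`, `n ≥ 0`, when `p i n` stands for the
probability of the state `(i, j₀ + n)`. -/
def IsBalanced (p : ℕ → ℕ → ℝ) (m : ℕ) : Prop :=
  ∀ n, (C.lam m + C.mu m + C.alphaTot m) * p m (n + 1) =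
    C.lam m * p m n + C.mu m * p m (n + 2)
      + C.inflow p m 1 n + C.inflow p m 0 (n + 1) + C.inflow p m (-1) (n + 2)

theorem isBalanced_coeff (p₀ : ℕ → ℝ) (hm : m ≤ M) (hlam : 0 < C.lam m)
    (hbase : C.base m = C.base 0) (hw : 1 - C.base 0 * C.phi m (C.alphaTot m) ≠ 0) :
    C.IsBalanced (fun i n => multichooseSum M (C.coeff p₀ i) n * C.base 0 ^ n) m := by
  have hr : C.base 0 ≠ 0 := hbase ▸ (C.base_pos hm hlam).ne'
  have hinflow : ∀ Δ u, m ≤ u → C.inflow (C.coeff p₀) m Δ u = 0 := fun Δ u hu =>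
    C.inflow_eq_zero (fun i hi => C.coeff_eq_zero p₀ (hi.trans_le hu)) Δ
  have htail := tail_sum_recurrence (m := m) (w := 1 - C.base 0 * C.phi m (C.alphaTot m))
    (b := fun u => C.inflow (C.coeff p₀) m (-1) u
      + C.inflow (C.coeff p₀) m 0 u * C.phi m (C.alphaTot m)
      + C.inflow (C.coeff p₀) m 1 u * C.phi m (C.alphaTot m) ^ 2)
    (fun u hu => by simp only [hinflow _ u hu, zero_mul, add_zero]) hw
  intro n
  simp only [← multichooseSum_inflow_mul_pow]
  exact multichooseSum_mul_pow_recurrence (fun Δ k hk => hinflow Δ k (by omega))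
    (fun k hk => C.coeff_eq_zero p₀ (by omega)) (hbase ▸ C.mu_mul_base hm hlam)
    (hbase ▸ C.rate_mul_base hm hlam)
    (coeff_difference_eq hr hlam.ne' hw htail (C.coeff_succ p₀ hbase)) n

end Coefficients

variable {C} in
theorem IsBalanced.recurrence {p : ℕ → ℕ → ℝ} (hp : C.IsBalanced p m) (hm : m ≤ M)
    (hlam : 0 < C.lam m) (n : ℕ) :
    C.lam m * ((1 + C.base m * C.phi m (C.alphaTot m)) * p m (n + 1)) =
      C.lam m * (C.base m * p m n + C.phi m (C.alphaTot m) * p m (n + 2)) +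
        C.base m * (C.inflow p m 1 n + C.inflow p m 0 (n + 1) + C.inflow p m (-1) (n + 2)) := by
  linear_combination C.base m * hp n - p m (n + 1) * C.rate_mul_base hm hlam
    + p m (n + 2) * C.mu_mul_base hm hlam

theorem eq_multichooseSum_of_isBalanced (hlam : ∀ m ≤ M, 0 < C.lam m)
    (hbase : ∀ m ≤ M, C.base m = C.base 0) (hr : C.base 0 < 1) {p : ℕ → ℕ → ℝ}
    (hlim : ∀ m ≤ M, Tendsto (p m) atTop (𝓝 0)) (hp : ∀ m ≤ M, C.IsBalanced p m) (m : ℕ)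
    (hm : m ≤ M) (n : ℕ) :
    p m n = multichooseSum M (C.coeff (fun i => p i 0) m) n * C.base 0 ^ n := by
  induction m using Nat.strong_induction_on generalizing n with
  | _ m ih =>
    have hr0 := C.base_pos (Nat.zero_le M) (hlam 0 (Nat.zero_le M))
    have hφ0 := C.phi_nonneg hm (hlam m hm)
    have hφ1 := C.phi_le_one (hlam m hm)
    have hw : 1 - C.base 0 * C.phi m (C.alphaTot m) ≠ 0 :=
      (sub_pos.2 (mul_lt_one_of_nonneg_of_lt_one_left hr0.le hr hφ1)).ne'
    let q : ℕ → ℕ → ℝ := fun i n => multichooseSum M (C.coeff (fun i => p i 0) i) n * C.base 0 ^ n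
    have hq : C.IsBalanced q m := C.isBalanced_coeff _ hm (hlam m hm) (hbase m hm) hw
    have hinflow (Δ : ℤ) (n : ℕ) : C.inflow p m Δ n = C.inflow q m Δ n :=
      C.inflow_congr (fun i hi => ih i hi (hi.le.trans hm) n) Δ
    have hdiff_lim : Tendsto (fun n => p m n - q m n) atTop (𝓝 0) := by
      have hnorm : ‖C.base 0‖ < 1 := by rwa [Real.norm_of_nonneg hr0.le]
      simpa only [sub_zero] using (hlim m hm).sub
        (hasSum_multichooseSum_mul_pow hnorm M _).summable.tendsto_atTop_zero
    have hdiff (n : ℕ) : (1 + C.base 0 * C.phi m (C.alphaTot m)) * (p m (n + 1) - q m (n + 1)) =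
        C.base 0 * (p m n - q m n) + C.phi m (C.alphaTot m) * (p m (n + 2) - q m (n + 2)) := by
      have hpn := (hp m hm).recurrence hm (hlam m hm) n
      have hqn := hq.recurrence hm (hlam m hm) n
      rw [hbase m hm] at hpn hqn
      simp only [hinflow] at hpn
      apply mul_left_cancel₀ (hlam m hm).ne'
      linear_combination hpn - hqn
    have hzero : q m 0 = p m 0 := by simp [q, multichooseSum_zero, coeff_zero]
    have := eq_pow_mul_of_recurrence_of_tendsto_zero hφ0 hφ1 hdiff_lim hdiff n
    rwa [hzero, sub_self, mul_zero, sub_eq_zero] at this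

end ClassM

theorem sum_ite_eq_add_sum_filter {ι R : Type*} [Fintype ι] [DecidableEq ι] [AddCommMonoid R]
    {m : ι} {p : ι → Prop} [DecidablePred p] (hm : ¬p m) (a b : ι → R) :
    ∑ i, (if i = m then a i else if p i then b i else 0) = a m + ∑ i with p i, b i := by
  have hsplit (i : ι) : (if i = m then a i else if p i then b i else 0) =
      (if i = m then a i else 0) + if p i then b i else 0 := by
    split_ifs with him hi hi <;> simp_all
  simp only [hsplit, sum_add_distrib, sum_ite_eq', mem_univ, if_true, sum_filter]

theorem sum_Iio_val {R : Type*} [AddCommMonoid R] {M : ℕ} (m : Fin (M + 1)) (f : ℕ → R) :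
    ∑ i ∈ Iio m, f i = ∑ i ∈ range m, f i := by
  rw [← Nat.Iio_eq_range, ← Fin.map_valEmbedding_Iio, sum_map]
  rfl

theorem sum_Ioi_val {R : Type*} [AddCommMonoid R] {M : ℕ} (m : Fin (M + 1)) (f : ℕ → R) :
    ∑ i ∈ Ioi m, f i = ∑ i ∈ Ioc (m : ℕ) M, f i := by
  have hmap : (Ioi m).map Fin.valEmbedding = Ioc (m : ℕ) M := by
    rw [Fin.map_valEmbedding_Ioi, Ioo_add_one_right_eq_Ioc]
  rw [← hmap, sum_map]
  rfl

section FiniteSupport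

variable {R : Type*} [AddCommMonoid R] [TopologicalSpace R] {f : ℕ → R}

theorem hasSum_of_eq_zero_of_one_lt (hf : ∀ l, 1 < l → f l = 0) : HasSum f (f 0 + f 1) := by
  rw [← sum_range_one f, ← sum_range_succ]
  exact hasSum_sum_of_ne_finset_zero fun l hl => hf l (by rw [mem_range] at hl; omega)

theorem hasSum_of_eq_zero_of_lt_or_lt (n : ℕ) (hf : ∀ l, l < n ∨ n + 2 < l → f l = 0) :
    HasSum f (f n + f (n + 1) + f (n + 2)) := by
  have hIco : ∑ l ∈ Ico n (n + 3), f l = f n + f (n + 1) + f (n + 2) := by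
    simp [sum_Ico_succ_top]
  rw [← hIco]
  exact hasSum_sum_of_ne_finset_zero fun l hl => hf l (by rw [mem_Ico] at hl; omega)

end FiniteSupport

section StateSpace

variable {N : Type*} {M j₀ : ℕ}

/-- The state of phase `m` that lies `n` levels above `j₀`. -/
abbrev State.level (m : Fin (M + 1)) (n : ℕ) : State N M j₀ :=
  State.rep m (j₀ + n) (Nat.le_add_right _ _)

theorem State.level_injective (m : Fin (M + 1)) :
    Function.Injective (State.level m : ℕ → State N M j₀) := fun a b hab => by
  simpa using hab

theorem hasSum_state {R : Type*} [AddCommMonoid R] [TopologicalSpace R] [ContinuousAdd R]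
    {g : State N M j₀ → R} {a : R} {s : Fin (M + 1) → R}
    (hinl : HasSum (fun x => g (Sum.inl x)) a)
    (hlevel : ∀ m, HasSum (fun n => g (State.level m n)) (s m)) : HasSum g (a + ∑ m, s m) := by
  refine hinl.sum ?_
  have hsplit : g ∘ Sum.inr = fun y => ∑ m, if y.1 = m then g (Sum.inr y) else 0 := by
    funext y
    simp
  rw [hsplit]
  refine hasSum_sum fun m _ => ?_
  have hinj : Function.Injective
      fun n : ℕ => ((m, ⟨j₀ + n, Nat.le_add_right _ _⟩) : Fin (M + 1) × {j : ℕ // j₀ ≤ j}) :=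
    fun a b hab => by simpa using hab
  refine (hinj.hasSum_iff ?_).1 (by simpa [Function.comp_def] using hlevel m)
  rintro ⟨i, j, hj⟩ hy
  refine if_neg ?_
  rintro rfl
  exact hy ⟨j - j₀, by simp [Nat.add_sub_cancel' hj]⟩

/-- The masses `π` of the states of the repeating portion, with phases indexed by `ℕ`; for a phase
`m > M` the value is that of `m % (M + 1)`. -/
def repProb {R : Type*} (π : State N M j₀ → R) (m n : ℕ) : R :=
  π (State.level (Fin.ofNat (M + 1) m) n)

theorem repProb_val {R : Type*} (π : State N M j₀ → R) (m : Fin (M + 1)) (n : ℕ) :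
    repProb π m n = π (State.level m n) := by
  rw [repProb, Fin.ofNat_val_eq_self]

end StateSpace

namespace ClassM

variable {N : Type*} {M j₀ : ℕ} (C : ClassM N M j₀)

section Rates

theorem rate_nonneg (x y : State N M j₀) : 0 ≤ C.rate x y := by
  rcases x with x | ⟨m, j, hj⟩ <;> rcases y with y | ⟨i, l, hl⟩ <;> simp only [rate]
  · exact C.qNN_nonneg x y
  · split_ifs
    exacts [C.qNR_nonneg _ _, le_rfl]
  · split_ifs
    exacts [C.qRN_nonneg _ _, le_rfl]
  · split_ifs with him hup hdown hphase
    · exact C.lam_nonneg m m.is_le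
    · exact C.mu_nonneg m m.is_le
    · exact le_rfl
    · exact C.alp_nonneg m i hphase.1 i.is_le _ (mem_Icc.2 (abs_le.1 hphase.2))
    · exact le_rfl

theorem rate_level (m i : Fin (M + 1)) (n l : ℕ) :
    C.rate (State.level m n) (State.level i l) =
      if i = m then if l = n + 1 then C.lam m else if n = l + 1 then C.mu m else 0
      else if m < i ∧ |(l : ℤ) - n| ≤ 1 then C.alp m (i - m) ((l : ℤ) - n) else 0 := by
  have hup : j₀ + l = j₀ + n + 1 ↔ l = n + 1 := by omega
  have hdown : j₀ + n = j₀ + l + 1 ↔ n = l + 1 := by omega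
  simp only [rate, hup, hdown, Nat.cast_add, add_sub_add_left_eq_sub]

theorem rate_level_eq_zero (m i : Fin (M + 1)) {n l : ℕ} (h : n + 1 < l ∨ l + 1 < n) :
    C.rate (State.level m n) (State.level i l) = 0 := by
  have hl : ¬|(l : ℤ) - n| ≤ 1 := by rw [abs_le]; omega
  rw [rate_level, if_neg (by omega : ¬l = n + 1), if_neg (by omega : ¬n = l + 1),
    if_neg (not_and_of_not_right _ hl), ite_self]

theorem hasSum_rate_level_succ (m i : Fin (M + 1)) (n : ℕ) :
    HasSum (fun l => C.rate (State.level m (n + 1)) (State.level i l))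
      (if i = m then C.mu m + C.lam m
        else if m < i then ∑ Δ ∈ Icc (-1 : ℤ) 1, C.alp m (i - m) Δ else 0) := by
  convert hasSum_of_eq_zero_of_lt_or_lt n
    fun l hl => C.rate_level_eq_zero m i (n := n + 1) (l := l) (by omega) using 1
  split_ifs with him hmi
  · simp [rate_level, him, add_assoc]
  · simp [rate_level, him, hmi, sum_Icc_neg_one_one]
  · simp [rate_level, him, hmi]

theorem hasSum_mul_rate_level_succ (f : ℕ → ℝ) (m i : Fin (M + 1)) (n : ℕ) :
    HasSum (fun l => f l * C.rate (State.level i l) (State.level m (n + 1)))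
      (if i = m then C.lam m * f n + C.mu m * f (n + 2)
        else if i < m then C.alp i (m - i) 1 * f n + C.alp i (m - i) 0 * f (n + 1)
          + C.alp i (m - i) (-1) * f (n + 2)
        else 0) := by
  convert hasSum_of_eq_zero_of_lt_or_lt n fun l hl =>
    mul_eq_zero_of_right (f l) (C.rate_level_eq_zero i m (n := l) (l := n + 1) (by omega)) using 1
  split_ifs with him hmi
  · simp [rate_level, him, mul_comm]
  · simp [rate_level, Ne.symm him, hmi, mul_comm]
  · simp [rate_level, Ne.symm him, hmi]

theorem hasSum_rate_level_zero (m i : Fin (M + 1)) :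
    HasSum (fun l => C.rate (State.level m 0) (State.level i l))
      (if i = m then C.lam m
        else if m < i then C.alp m (i - m) 0 + C.alp m (i - m) 1 else 0) := by
  convert hasSum_of_eq_zero_of_one_lt
    fun l hl => C.rate_level_eq_zero m i (n := 0) (l := l) (by omega) using 1
  split_ifs with him hmi
  · simp [rate_level, him]
  · simp [rate_level, him, hmi]
  · simp [rate_level, him, hmi]

theorem hasSum_mul_rate_level_zero (f : ℕ → ℝ) (m i : Fin (M + 1)) :
    HasSum (fun l => f l * C.rate (State.level i l) (State.level m 0))
      (if i = m then C.mu m * f 1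
        else if i < m then C.alp i (m - i) (-1) * f 1 + C.alp i (m - i) 0 * f 0 else 0) := by
  convert hasSum_of_eq_zero_of_one_lt fun l hl =>
    mul_eq_zero_of_right (f l) (C.rate_level_eq_zero i m (n := l) (l := 0) (by omega)) using 1
  split_ifs with him hmi
  · simp [rate_level, him, mul_comm]
  · simp [rate_level, Ne.symm him, hmi, mul_comm, add_comm]
  · simp [rate_level, Ne.symm him, hmi]

theorem hasSum_rate_succ (m : Fin (M + 1)) (n : ℕ) :
    HasSum (C.rate (State.level m (n + 1))) (C.lam m + C.mu m + C.alphaTot m) := by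
  have hinl : HasSum (fun x => C.rate (State.level m (n + 1)) (Sum.inl x)) 0 := by
    simp [rate, hasSum_zero]
  convert hasSum_state hinl fun i => C.hasSum_rate_level_succ m i n using 1
  rw [zero_add, sum_ite_eq_add_sum_filter (lt_irrefl m), filter_lt_eq_Ioi,
    sum_Ioi_val m fun i => ∑ Δ ∈ Icc (-1 : ℤ) 1, C.alp m (i - m) Δ, alphaTot,
    add_comm (C.lam m)]

theorem hasSum_mul_rate_succ (π : State N M j₀ → ℝ) (m : Fin (M + 1)) (n : ℕ) :
    HasSum (fun y => π y * C.rate y (State.level m (n + 1)))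
      (C.lam m * repProb π m n + C.mu m * repProb π m (n + 2)
        + C.inflow (repProb π) m 1 n + C.inflow (repProb π) m 0 (n + 1)
        + C.inflow (repProb π) m (-1) (n + 2)) := by
  have hinl : HasSum (fun x => π (Sum.inl x) * C.rate (Sum.inl x) (State.level m (n + 1))) 0 := by
    simp [rate, hasSum_zero]
  convert hasSum_state (g := fun y => π y * C.rate y (State.level m (n + 1))) hinl
    fun i => C.hasSum_mul_rate_level_succ (fun l => π (State.level i l)) m i n using 1
  simp only [← repProb_val]
  rw [zero_add, sum_ite_eq_add_sum_filter (p := (· < m)) (lt_irrefl m), filter_gt_eq_Iio,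
    sum_Iio_val m fun i => C.alp i (m - i) 1 * repProb π i n
      + C.alp i (m - i) 0 * repProb π i (n + 1) + C.alp i (m - i) (-1) * repProb π i (n + 2)]
  simp only [inflow, sum_add_distrib, add_assoc]

theorem hasSum_rate_zero [Fintype N] (m : Fin (M + 1)) :
    HasSum (C.rate (State.level m 0))
      (C.lam m
        + (∑ i ∈ Ioi m, (C.alp m (i - m) 0 + C.alp m (i - m) 1))
        + ∑ x : N, C.rate (State.level m 0) (Sum.inl x)) := by
  convert hasSum_state (hasSum_fintype _) fun i => C.hasSum_rate_level_zero m i using 1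
  rw [sum_ite_eq_add_sum_filter (lt_irrefl m), filter_lt_eq_Ioi, add_comm]

theorem hasSum_mul_rate_zero [Fintype N] (π : State N M j₀ → ℝ) (m : Fin (M + 1)) :
    HasSum (fun y => π y * C.rate y (State.level m 0))
      (C.mu m * π (State.level m 1)
        + (∑ x : N, C.rate (Sum.inl x) (State.level m 0) * π (Sum.inl x))
        + ∑ i ∈ Iio m, (C.alp i (m - i) (-1) * π (State.level i 1)
          + C.alp i (m - i) 0 * π (State.level i 0))) := by
  convert hasSum_state (g := fun y => π y * C.rate y (State.level m 0)) (hasSum_fintype _)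
    fun i => C.hasSum_mul_rate_level_zero (fun l => π (State.level i l)) m i using 1
  rw [sum_ite_eq_add_sum_filter (p := (· < m)) (lt_irrefl m), filter_gt_eq_Iio]
  simp only [mul_comm (π (Sum.inl _)), add_assoc, add_left_comm]

theorem hasSum_rate_inl [Fintype N] (x : N) :
    HasSum (C.rate (Sum.inl x))
      ((∑ m, C.rate (Sum.inl x) (State.level m 0)) + ∑ y, C.rate (Sum.inl x) (Sum.inl y)) := by
  have hphase (m : Fin (M + 1)) : HasSum (fun l => C.rate (Sum.inl x) (State.level m l))
      (C.rate (Sum.inl x) (State.level m 0)) :=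
    hasSum_single 0 fun l hl => by simp [rate, hl]
  convert hasSum_state (hasSum_fintype _) hphase using 1
  exact add_comm _ _

theorem hasSum_mul_rate_inl [Fintype N] (π : State N M j₀ → ℝ) (x : N) :
    HasSum (fun y => π y * C.rate y (Sum.inl x))
      ((∑ m, C.rate (State.level m 0) (Sum.inl x) * π (State.level m 0))
        + ∑ y, C.rate (Sum.inl y) (Sum.inl x) * π (Sum.inl y)) := by
  have hphase (m : Fin (M + 1)) :
      HasSum (fun l => π (State.level m l) * C.rate (State.level m l) (Sum.inl x))
        (π (State.level m 0) * C.rate (State.level m 0) (Sum.inl x)) :=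
    hasSum_single 0 fun l hl => by simp [rate, hl]
  convert hasSum_state (g := fun y => π y * C.rate y (Sum.inl x)) (hasSum_fintype _) hphase using 1
  simp only [mul_comm (π _), add_comm]

theorem summable_mul_rate [Finite N] (π : State N M j₀ → ℝ) (y : State N M j₀) :
    Summable fun x => π x * C.rate x y := by
  cases nonempty_fintype N
  rcases y with x | ⟨m, j, hj⟩
  · exact (C.hasSum_mul_rate_inl π x).summable
  · obtain ⟨_ | n, rfl⟩ := Nat.exists_eq_add_of_le hj
    · exact (C.hasSum_mul_rate_zero π m).summable
    · exact (C.hasSum_mul_rate_succ π m n).summable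

end Rates

section Stationary

variable {C} {π : State N M j₀ → ℝ}

theorem IsStationary.tendsto_repProb (hπ : C.IsStationary π) (m : ℕ) :
    Tendsto (repProb π m) atTop (𝓝 0) :=
  (hπ.hasSum_one.summable.comp_injective (State.level_injective _)).tendsto_atTop_zero

theorem IsStationary.isBalanced (hπ : C.IsStationary π) {m : ℕ} (hm : m ≤ M) :
    C.IsBalanced (repProb π) m := fun n => by
  lift m to Fin (M + 1) using Nat.lt_succ_of_le hm
  rw [← (C.hasSum_mul_rate_succ π m n).tsum_eq, ← hπ.balance, (C.hasSum_rate_succ m n).tsum_eq,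
    repProb_val, mul_comm]

theorem IsStationary.pos [Finite N] (hπ : C.IsStationary π) (hC : C.IsIrreducible)
    (y : State N M j₀) : 0 < π y := by
  refine (hπ.nonneg y).lt_of_ne' fun hy => ?_
  have hzero : ∀ x, π x = 0 := by
    intro x
    induction hC x y using Relation.ReflTransGen.head_induction_on with
    | refl => exact hy
    | @head a b hab _ hb =>
      have hinflow := hπ.balance b
      rw [hb, zero_mul] at hinflow
      have hterm := congrFun ((hasSum_zero_iff_of_nonneg
        fun x => mul_nonneg (hπ.nonneg x) (C.rate_nonneg x b)).1
          (hinflow ▸ (C.summable_mul_rate π b).hasSum)) a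
      exact (mul_eq_zero.1 hterm).resolve_right hab.ne'
  exact zero_ne_one (hasSum_zero.unique (funext hzero ▸ hπ.hasSum_one))

-- Dropping the inflow leaves `r_m p n ≤ p (n + 1)`; if `r_m ≥ 1`, then the masses `p` of phase `m`
-- increase with the level, which contradicts summability.
theorem IsStationary.base_lt_one [Finite N] (hπ : C.IsStationary π) (hC : C.IsIrreducible)
    {m : ℕ} (hm : m ≤ M) (hlam : 0 < C.lam m) : C.base m < 1 := by
  by_contra! hbase
  have hp0 (i n : ℕ) : 0 ≤ repProb π i n := hπ.nonneg _
  have hrec (n : ℕ) : C.base m * repProb π m n + C.phi m (C.alphaTot m) * repProb π m (n + 2) ≤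
      (1 + C.base m * C.phi m (C.alphaTot m)) * repProb π m (n + 1) := by
    have hinflow (Δ : ℤ) (hΔ : Δ ∈ Icc (-1) 1) (n : ℕ) : 0 ≤ C.inflow (repProb π) m Δ n :=
      C.inflow_nonneg hm hΔ fun i _ => hp0 i n
    refine le_of_mul_le_mul_left ?_ hlam
    rw [(hπ.isBalanced hm).recurrence hm hlam n]
    exact le_add_of_nonneg_right (mul_nonneg (zero_le_one.trans hbase) (add_nonneg
      (add_nonneg (hinflow 1 (by simp) _) (hinflow 0 (by simp) _)) (hinflow (-1) (by simp) _)))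
  have hmono : Monotone (repProb π m) := monotone_nat_of_le_succ fun n =>
    (le_mul_of_one_le_left (hp0 m n) hbase).trans <| mul_le_succ_of_le_of_tendsto_zero
      (C.phi_nonneg hm hlam) (C.phi_le_one hlam) (hπ.tendsto_repProb m) hrec n
  exact (hmono.ge_of_tendsto (hπ.tendsto_repProb m) 0).not_gt (hπ.pos hC _)

theorem IsStationary.level_eq (hπ : C.IsStationary π) (hlam : ∀ m ≤ M, 0 < C.lam m)
    (hbase : ∀ m ≤ M, C.base m = C.base 0) (hr : C.base 0 < 1) (m : Fin (M + 1)) (n : ℕ) :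
    π (State.level m n) =
      multichooseSum m (C.coeff (fun i => repProb π i 0) m) n * C.base 0 ^ n := by
  rw [← repProb_val π, multichooseSum_eq_of_le m.is_le fun k => C.coeff_eq_zero _]
  exact C.eq_multichooseSum_of_isBalanced hlam hbase hr (fun i _ => hπ.tendsto_repProb i)
    (fun i hi => hπ.isBalanced hi) m m.is_le n

end Stationary

end ClassM

theorem theorem4_general {N : Type*} [Fintype N] {M j₀ : ℕ} (C : ClassM N M j₀)
    (hlam : ∀ m ≤ M, 0 < C.lam m)
    (hbase : ∀ m ≤ M, C.base m = C.base 0)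
    (hr : C.base 0 < 1)
    (π : State N M j₀ → ℝ) (hπ : C.IsStationary π) :
    ∃ c : ℕ → ℕ → ℝ,
      (∀ (m : Fin (M + 1)) (j : ℕ) (hj : j₀ ≤ j),
        π (State.rep m j hj) =
          ∑ k ∈ Finset.range (m + 1),
            c m k * ((j - j₀ + k - 1).choose k : ℝ) * C.base 0 ^ (j - j₀)) ∧
      (∀ m : Fin (M + 1), c m 0 = π (State.rep m j₀ le_rfl)) ∧
      (∀ m k : ℕ, m ≤ M → 1 ≤ k → k < m →
        c m k =
          C.Omega m * C.base 0 *
              (∑ u ∈ Finset.Ico k m, ∑ i ∈ Finset.Ico u m,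
                c i u * ∑ Δ ∈ Finset.Icc (-1 : ℤ) 1,
                  C.alp i (m - i) Δ * C.phi m (C.alphaTot m) ^ (Δ + 1) /
                    (1 - C.base 0 * C.phi m (C.alphaTot m)) ^ (u + 1 - k))
            - 1 / C.lam m * (∑ i ∈ Finset.Ico k m, c i k * C.alp i (m - i) 1)
            + C.Omega m *
              (∑ i ∈ Finset.Ico (k - 1) m,
                c i (k - 1) * ∑ Δ ∈ Finset.Icc (-1 : ℤ) 1,
                  C.alp i (m - i) Δ * C.base 0 ^ (-Δ))) ∧
      (∀ m : ℕ, 1 ≤ m → m ≤ M →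
        c m m = c (m - 1) (m - 1) * C.Omega m *
          ∑ Δ ∈ Finset.Icc (-1 : ℤ) 1, C.alp (m - 1) 1 Δ * C.base 0 ^ (-Δ)) ∧
      (∀ m : Fin (M + 1),
        π (State.rep m j₀ le_rfl) *
            (C.lam m
              + (∑ i ∈ Finset.Ioi m, (C.alp m (i - m) 0 + C.alp m (i - m) 1))
              + ∑ x : N, C.rate (State.rep m j₀ le_rfl) (Sum.inl x)) =
          C.mu m * (∑ k ∈ Finset.range (m + 1), c m k * C.base 0)
            + (∑ x : N, C.rate (Sum.inl x) (State.rep m j₀ le_rfl) * π (Sum.inl x))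
            + ∑ i ∈ Finset.Iio m,
                (C.alp i (m - i) (-1) * (∑ k ∈ Finset.range (i + 1), c i k * C.base 0)
                  + C.alp i (m - i) 0 * π (State.rep i j₀ le_rfl))) ∧
      (∀ x : N,
        π (Sum.inl x) *
            ((∑ m : Fin (M + 1), C.rate (Sum.inl x) (State.rep m j₀ le_rfl))
              + ∑ y : N, C.rate (Sum.inl x) (Sum.inl y)) =
          (∑ m : Fin (M + 1),
              C.rate (State.rep m j₀ le_rfl) (Sum.inl x) * π (State.rep m j₀ le_rfl))
            + ∑ y : N, C.rate (Sum.inl y) (Sum.inl x) * π (Sum.inl y)) ∧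
      (∑ x : N, π (Sum.inl x))
        + ∑ m : Fin (M + 1),
            (c m 0 / (1 - C.base 0)
              + ∑ k ∈ Finset.Icc 1 (m : ℕ), c m k * C.base 0 / (1 - C.base 0) ^ (k + 1)) = 1 := by
  have hnorm : ‖C.base 0‖ < 1 := by
    rwa [Real.norm_of_nonneg (C.base_pos (Nat.zero_le M) (hlam 0 (Nat.zero_le M))).le]
  let c := C.coeff fun i => repProb π i 0
  have hlevel := hπ.level_eq hlam hbase hr
  have hone (m : Fin (M + 1)) : π (State.level m 1) = ∑ k ∈ range (m + 1), c m k * C.base 0 := by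
    rw [hlevel, multichooseSum_one, sum_mul, pow_one]
  refine ⟨c, fun m j hj => ?_, fun m => ?_, fun m k _ hk _ => C.coeff_eq_coeffStep _ m hk,
    fun m hm _ => C.coeff_self _ hm, fun m => ?_, fun x => ?_, ?_⟩
  · obtain ⟨n, rfl⟩ := Nat.exists_eq_add_of_le hj
    rw [hlevel, multichooseSum, sum_mul, Nat.add_sub_cancel_left]
    simp only [Nat.multichoose_eq, c]
  · exact (C.coeff_zero _ m).trans (repProb_val π m 0)
  · have h := hπ.balance (State.level m 0)
    rw [(C.hasSum_rate_zero m).tsum_eq, (C.hasSum_mul_rate_zero π m).tsum_eq] at h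
    simp only [hone] at h
    exact h
  · have h := hπ.balance (Sum.inl x)
    rwa [(C.hasSum_rate_inl x).tsum_eq, (C.hasSum_mul_rate_inl π x).tsum_eq] at h
  · refine (hasSum_state (hasSum_fintype _) fun m => ?_).unique hπ.hasSum_one
    simpa only [hlevel] using hasSum_multichooseSum_mul_pow hnorm m (c m)

/-- In the first conjunct the natural-number binomial `(j - j₀ + k - 1).choose k` is
`C(j - (j₀ + 1) + k, k)` also at `j = j₀`, where it is `1` for `k = 0` and `0` for `k ≥ 1`. -/
theorem theorem4 {N : Type*} [Fintype N] {M j₀ : ℕ} (C : ClassM N M j₀)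
    (hErg : C.IsErgodic)
    (hpos : ∀ m ≤ M, 0 < C.lam m ∧ 0 < C.mu m)
    (hbase : ∀ m ≤ M, C.base m = C.base 0)
    (π : State N M j₀ → ℝ) (hπ : C.IsStationary π) :
    ∃ c : ℕ → ℕ → ℝ,
      -- the form of the stationary probabilities
      (∀ (m : Fin (M + 1)) (j : ℕ) (hj : j₀ ≤ j),
        π (State.rep m j hj) =
          ∑ k ∈ Finset.range (m + 1),
            c m k * ((j - j₀ + k - 1).choose k : ℝ) * C.base 0 ^ (j - j₀)) ∧
      -- the coefficients with `k = 0`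
      (∀ m : Fin (M + 1), c m 0 = π (State.rep m j₀ le_rfl)) ∧
      -- the coefficients with `1 ≤ k ≤ m - 1`
      (∀ m k : ℕ, m ≤ M → 1 ≤ k → k < m →
        c m k =
          C.Omega m * C.base 0 *
              (∑ u ∈ Finset.Ico k m, ∑ i ∈ Finset.Ico u m,
                c i u * ∑ Δ ∈ Finset.Icc (-1 : ℤ) 1,
                  C.alp i (m - i) Δ * C.phi m (C.alphaTot m) ^ (Δ + 1) /
                    (1 - C.base 0 * C.phi m (C.alphaTot m)) ^ (u + 1 - k))
            - 1 / C.lam m * (∑ i ∈ Finset.Ico k m, c i k * C.alp i (m - i) 1)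
            + C.Omega m *
              (∑ i ∈ Finset.Ico (k - 1) m,
                c i (k - 1) * ∑ Δ ∈ Finset.Icc (-1 : ℤ) 1,
                  C.alp i (m - i) Δ * C.base 0 ^ (-Δ))) ∧
      -- the coefficients with `k = m ≥ 1`
      (∀ m : ℕ, 1 ≤ m → m ≤ M →
        c m m = c (m - 1) (m - 1) * C.Omega m *
          ∑ Δ ∈ Finset.Icc (-1 : ℤ) 1, C.alp (m - 1) 1 Δ * C.base 0 ^ (-Δ)) ∧
      -- the balance equation of the state `(m, j₀)`
      (∀ m : Fin (M + 1),
        π (State.rep m j₀ le_rfl) *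
            (C.lam m
              + (∑ i ∈ Finset.Ioi m, (C.alp m (i - m) 0 + C.alp m (i - m) 1))
              + ∑ x : N, C.rate (State.rep m j₀ le_rfl) (Sum.inl x)) =
          C.mu m * (∑ k ∈ Finset.range (m + 1), c m k * C.base 0)
            + (∑ x : N, C.rate (Sum.inl x) (State.rep m j₀ le_rfl) * π (Sum.inl x))
            + ∑ i ∈ Finset.Iio m,
                (C.alp i (m - i) (-1) * (∑ k ∈ Finset.range (i + 1), c i k * C.base 0)
                  + C.alp i (m - i) 0 * π (State.rep i j₀ le_rfl))) ∧
      -- the balance equation of a state of the non-repeating portion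
      (∀ x : N,
        π (Sum.inl x) *
            ((∑ m : Fin (M + 1), C.rate (Sum.inl x) (State.rep m j₀ le_rfl))
              + ∑ y : N, C.rate (Sum.inl x) (Sum.inl y)) =
          (∑ m : Fin (M + 1),
              C.rate (State.rep m j₀ le_rfl) (Sum.inl x) * π (State.rep m j₀ le_rfl))
            + ∑ y : N, C.rate (Sum.inl y) (Sum.inl x) * π (Sum.inl y)) ∧
      -- normalization
      (∑ x : N, π (Sum.inl x))
        + ∑ m : Fin (M + 1),
            (c m 0 / (1 - C.base 0)
              + ∑ k ∈ Finset.Icc 1 (m : ℕ), c m k * C.base 0 / (1 - C.base 0) ^ (k + 1)) = 1 :=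
  theorem4_general C (fun m hm => (hpos m hm).1) hbase
    (hπ.base_lt_one hErg.1 (Nat.zero_le M) (hpos 0 (Nat.zero_le M)).1) π hπ
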